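/- Let $n\ge 0$ and let $\lambda\vdash n$ be a partition, identified with its Ferrers diagram, with cells in row $j$ and column $i$ (both counted from $0$); the content of such a cell $w$ is $c(w)=i-j$. Let $f^{\lambda}$ be the number of standard tableaux of shape $\lambda$. For a partition $\mu$ whose diagram is contained in that of $\lambda$, let $f^{\lambda/\mu}$ be the number of skew tableaux of shape $\lambda/\mu$, i.e. of bijective fillings of the cells of $\lambda$ not in $\mu$ by $1,2,\dots,|\lambda|-|\mu|$ that increase along rows and columns; put $f^{\lambda/\mu}=0$ if $\mu\not\subseteq\lambda$. For a partition $\alpha=(\alpha_1,\dots,\alpha_l)$ define the content power sum \[ cp^{\alpha}(\lambda)=\prod_{i=1}^{l}\ \sum_{w\in\lambda} c(w)^{\alpha_i-1},\qquad\text{with } 0^0=1, \] and let $(n)_4=n(n-1)(n-2)(n-3)$. Then \begin{align*} (n)_{4}\, f^{\lambda/(4)}/f^{\lambda} &= \tfrac{1}{24}\, cp^{(1,1,1,1)}(\lambda) + \tfrac{1}{2}\, cp^{(2,1,1)}(\lambda) + \tfrac{1}{2}\, cp^{(2,2)}(\lambda) + cp^{(3,1)}(\lambda) + cp^{(4)}(\lambda)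 \\ &\quad - \tfrac{3}{4}\, cp^{(1,1,1)}(\lambda) - \tfrac{9}{2}\, cp^{(2,1)}(\lambda) - \tfrac{9}{2}\, cp^{(3)}(\lambda) + \tfrac{71}{24}\, cp^{(1,1)}(\lambda) + 6\, cp^{(2)}(\lambda) - \tfrac{9}{4}\, cp^{(1)}(\lambda). \end{align*} -/

import Mathlib

namespace SkewCount

/-- Standard fillings of a finite set `C` of cells `(row, column)`: the numbers `1, …, #C` are placed
in the cells of `C`, each exactly once, increasing along every row (with the column index) and along
every column (with the row index). -/
def StandardFilling (C : Finset (ℕ × ℕ)) : Type :=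
  {T : ↥C ≃ ↥(Finset.Icc 1 C.card) //
    (∀ u v : ↥C, u.1.1 = v.1.1 → u.1.2 < v.1.2 → (T u : ℕ) < (T v : ℕ)) ∧
    (∀ u v : ↥C, u.1.2 = v.1.2 → u.1.1 < v.1.1 → (T u : ℕ) < (T v : ℕ))}

instance (C : Finset (ℕ × ℕ)) : Finite (StandardFilling C) :=
  inferInstanceAs (Finite (Subtype _))

/-- `f^lam`: the number of standard tableaux of shape `lam`. -/
noncomputable def numStandard (lam : YoungDiagram) : ℕ :=
  Nat.card (StandardFilling lam.cells)

open Classical in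
/-- `f^(lam/mu)`: the number of skew tableaux of shape `lam/mu`; if the diagram of `lam` does not
contain that of `mu`, there is no skew shape `lam/mu`, and the number is `0`. -/
noncomputable def numSkew (lam mu : YoungDiagram) : ℕ :=
  if mu ≤ lam then Nat.card (StandardFilling (lam.cells \ mu.cells)) else 0

/-- The content of a cell `(row, column)`, both counted from `0`. -/
def content (w : ℕ × ℕ) : ℤ := (w.2 : ℤ) - (w.1 : ℤ)

/-- The content power sum `cp^α(lam) = ∏ᵢ ∑_{w ∈ lam} c(w)^(αᵢ - 1)`, with `0 ^ 0 = 1`. The partition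
`α` is given as the multiset of its (positive) parts. -/
def cp (α : Multiset ℕ+) (lam : YoungDiagram) : ℤ :=
  (α.map fun a => ∑ w ∈ lam.cells, content w ^ ((a : ℕ) - 1)).prod

/-- The one-row partition `(k)`, for `k ≥ 1`. -/
def oneRow (k : ℕ) : YoungDiagram :=
  YoungDiagram.ofRowLens [k] (List.pairwise_singleton _ k).sortedGE

end SkewCount

open Finset Polynomial

namespace SkewCount

/-! Let `N + 1` rows have lengths m_i, padded by zero, and put l_i = m_i + N - i. Let D_k be the
determinant of the falling factorials (l_i)_{a_j}, with a_0 = N + k and a_j = N - j for j > 0.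
Aitken's formula says f^{λ/(k)} ∏ l_i! = (n - k)! D_k. It holds because removing the largest entry
gives a branching rule for the left side (`card_standardFilling_eq_sum`), and D_k satisfies the
matching recurrence (`sum_mul_fallingDet_update`), in which rows without a removable cell contribute
zero (`mul_fallingDet_eq_zero`). The quantity sought is therefore D_4 / D_0.

In the variable u = l - N, D_0 is up to sign the Vandermonde determinant of the points m_i - i. D_4
differs in one column, which now evaluates A(u)(u-1)(u-2)(u-3), where A = ∏ (u + i) over i ≤ N.
Modulo Φ = ∏ (u - m_i + i) this polynomial becomes a remainder of degree at most N, of which only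
the coefficient at u^N survives in the determinant. So D_4 / D_0 is the coefficient of 1/u in
A(u)(u-1)(u-2)(u-3)/Φ(u).

Each ratio (u + i)/(u + i - m_i) telescopes along row i, so A/Φ is the product of (u - c)/(u - c -
1) over all cells, c being the content. Its coefficients at u^-1, …, u^-4 are `g1`, …, `g4`,
polynomials in the content power sums, and (u-1)(u-2)(u-3) = u^3 - 6u^2 + 11u - 6 combines them into
`rowFour`. -/

/-! ### Fillings and the branching rule -/

/-- Standard fillings of `C`, extended by `0` to functions on all cells. -/
structure IsFilling (C : Finset (ℕ × ℕ)) (T : ℕ × ℕ → ℕ) : Prop where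
  bijOn : Set.BijOn T C (Finset.Icc 1 C.card)
  eq_zero : ∀ u ∉ C, T u = 0
  row : ∀ u ∈ C, ∀ v ∈ C, u.1 = v.1 → u.2 < v.2 → T u < T v
  col : ∀ u ∈ C, ∀ v ∈ C, u.2 = v.2 → u.1 < v.1 → T u < T v

/-- Extension by `0` of a standard filling. -/
def StandardFilling.extend {C : Finset (ℕ × ℕ)} (T : StandardFilling C) (u : ℕ × ℕ) : ℕ :=
  if h : u ∈ C then (T.1 ⟨u, h⟩ : ℕ) else 0

lemma StandardFilling.extend_of_mem {C : Finset (ℕ × ℕ)} (T : StandardFilling C) {u : ℕ × ℕ}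
    (h : u ∈ C) : T.extend u = (T.1 ⟨u, h⟩ : ℕ) := dif_pos h

lemma StandardFilling.isFilling_extend {C : Finset (ℕ × ℕ)} (T : StandardFilling C) :
    IsFilling C T.extend where
  bijOn := by
    refine ⟨fun u hu => ?_, fun u hu v hv huv => ?_, fun x hx => ?_⟩
    · rw [T.extend_of_mem hu]
      exact (T.1 ⟨u, hu⟩).2
    · rw [T.extend_of_mem hu, T.extend_of_mem hv] at huv
      exact congrArg Subtype.val (T.1.injective (Subtype.ext huv))
    · refine ⟨(T.1.symm ⟨x, hx⟩).1, (T.1.symm ⟨x, hx⟩).2, ?_⟩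
      rw [T.extend_of_mem (T.1.symm ⟨x, hx⟩).2]
      simp
  eq_zero u hu := dif_neg hu
  row u hu v hv h1 h2 := by
    rw [T.extend_of_mem hu, T.extend_of_mem hv]
    exact T.2.1 ⟨u, hu⟩ ⟨v, hv⟩ h1 h2
  col u hu v hv h1 h2 := by
    rw [T.extend_of_mem hu, T.extend_of_mem hv]
    exact T.2.2 ⟨u, hu⟩ ⟨v, hv⟩ h1 h2

lemma bijective_extend (C : Finset (ℕ × ℕ)) :
    Function.Bijective
      (fun T : StandardFilling C => (⟨T.extend, T.isFilling_extend⟩ : {T // IsFilling C T})) := by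
  constructor
  · intro S T h
    have h' : S.extend = T.extend := congrArg Subtype.val h
    refine Subtype.ext (Equiv.ext fun u => Subtype.ext ?_)
    have := congrFun h' u.1
    rwa [S.extend_of_mem u.2, T.extend_of_mem u.2] at this
  · rintro ⟨T, hT⟩
    let e : ↥C ≃ ↥(Finset.Icc 1 C.card) := Equiv.ofBijective
      (fun u => ⟨T u.1, hT.bijOn.mapsTo u.2⟩)
      ⟨fun u v h => Subtype.ext (hT.bijOn.injOn u.2 v.2 (congrArg Subtype.val h)), fun x => by
        obtain ⟨u, hu, hux⟩ := hT.bijOn.surjOn x.2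
        exact ⟨⟨u, hu⟩, Subtype.ext hux⟩⟩
    have he : ∀ u, (e u : ℕ) = T u.1 := fun u => rfl
    refine ⟨⟨e, fun u v h1 h2 => ?_, fun u v h1 h2 => ?_⟩, Subtype.ext (funext fun u => ?_)⟩
    · rw [he, he]; exact hT.row _ u.2 _ v.2 h1 h2
    · rw [he, he]; exact hT.col _ u.2 _ v.2 h1 h2
    · by_cases hu : u ∈ C
      · exact StandardFilling.extend_of_mem _ hu
      · exact (dif_neg hu).trans (hT.eq_zero u hu).symm

lemma finite_isFilling (C : Finset (ℕ × ℕ)) : {T | IsFilling C T}.Finite :=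
  Set.finite_coe_iff.mp <| Finite.of_surjective _ (bijective_extend C).2

/-- The extended standard fillings of `C`. -/
noncomputable def fillings (C : Finset (ℕ × ℕ)) : Finset (ℕ × ℕ → ℕ) :=
  (finite_isFilling C).toFinset

lemma mem_fillings {C : Finset (ℕ × ℕ)} {T : ℕ × ℕ → ℕ} : T ∈ fillings C ↔ IsFilling C T := by
  simp [fillings]

lemma card_standardFilling (C : Finset (ℕ × ℕ)) :
    Nat.card (StandardFilling C) = (fillings C).card := by
  rw [Nat.card_eq_of_bijective _ (bijective_extend C)]
  exact Nat.card_eq_card_finite_toFinset (finite_isFilling C)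

/-- The cell `w` is last in `C` among the cells of its row and among those of its column. -/
def IsCorner (C : Finset (ℕ × ℕ)) (w : ℕ × ℕ) : Prop :=
  w ∈ C ∧ ∀ u ∈ C, (u.1 = w.1 → u.2 ≤ w.2) ∧ (u.2 = w.2 → u.1 ≤ w.1)

lemma IsFilling.le_card {C : Finset (ℕ × ℕ)} {T : ℕ × ℕ → ℕ} (hT : IsFilling C T) (u : ℕ × ℕ) :
    T u ≤ C.card := by
  by_cases hu : u ∈ C
  · exact (Finset.mem_Icc.mp (hT.bijOn.mapsTo hu)).2
  · simp [hT.eq_zero u hu]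

lemma IsFilling.exists_corner {C : Finset (ℕ × ℕ)} {T : ℕ × ℕ → ℕ} (hT : IsFilling C T)
    (hC : C.Nonempty) : ∃ w, IsCorner C w ∧ T w = C.card := by
  have h1 : 1 ≤ C.card := hC.card_pos
  obtain ⟨w, hw, hwC⟩ := hT.bijOn.surjOn (Finset.mem_coe.mpr (Finset.mem_Icc.mpr ⟨h1, le_rfl⟩))
  refine ⟨w, ⟨hw, fun u hu => ⟨fun h => ?_, fun h => ?_⟩⟩, hwC⟩
  · by_contra! hlt
    exact absurd (hT.row w hw u hu h.symm hlt) (by rw [hwC]; exact not_lt.mpr (hT.le_card u))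
  · by_contra! hlt
    exact absurd (hT.col w hw u hu h.symm hlt) (by rw [hwC]; exact not_lt.mpr (hT.le_card u))

lemma IsFilling.erase {C : Finset (ℕ × ℕ)} {T : ℕ × ℕ → ℕ} (hT : IsFilling C T) {w : ℕ × ℕ}
    (hw : w ∈ C) (hTw : T w = C.card) : IsFilling (C.erase w) (Function.update T w 0) := by
  have key : ∀ u ∈ C.erase w, Function.update T w 0 u = T u := fun u hu =>
    Function.update_of_ne (Finset.ne_of_mem_erase hu) _ _
  have hc : (C.erase w).card + 1 = C.card := Finset.card_erase_add_one hw
  refine ⟨⟨fun u hu => ?_, fun u hu v hv h => ?_, fun x hx => ?_⟩, fun u hu => ?_,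
    fun u hu v hv => ?_, fun u hu v hv => ?_⟩
  · rw [key u hu]
    have hu' : u ∈ C := Finset.mem_of_mem_erase hu
    have h1 := Finset.mem_Icc.mp (hT.bijOn.mapsTo hu')
    have h2 : T u ≠ C.card := fun h =>
      Finset.ne_of_mem_erase hu (hT.bijOn.injOn hu' hw (h.trans hTw.symm))
    exact Finset.mem_coe.mpr (Finset.mem_Icc.mpr (by omega))
  · rw [key u hu, key v hv] at h
    exact hT.bijOn.injOn (Finset.mem_of_mem_erase hu) (Finset.mem_of_mem_erase hv) h
  · have hx' := Finset.mem_Icc.mp hx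
    obtain ⟨u, hu, hux⟩ := hT.bijOn.surjOn
      (Finset.mem_coe.mpr (Finset.mem_Icc.mpr (⟨hx'.1, by omega⟩ : 1 ≤ x ∧ x ≤ C.card)))
    have hne : u ≠ w := by
      rintro rfl
      omega
    have hmem : u ∈ C.erase w := Finset.mem_erase.mpr ⟨hne, hu⟩
    exact ⟨u, hmem, (key u hmem).trans hux⟩
  · by_cases h : u = w
    · simp [h]
    · rw [Function.update_of_ne h]
      exact hT.eq_zero u fun h' => hu (Finset.mem_erase.mpr ⟨h, h'⟩)
  · rw [key u hu, key v hv]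
    exact hT.row u (Finset.mem_of_mem_erase hu) v (Finset.mem_of_mem_erase hv)
  · rw [key u hu, key v hv]
    exact hT.col u (Finset.mem_of_mem_erase hu) v (Finset.mem_of_mem_erase hv)

lemma IsFilling.insert {C : Finset (ℕ × ℕ)} {T : ℕ × ℕ → ℕ} {w : ℕ × ℕ} (hw : IsCorner C w)
    (hT : IsFilling (C.erase w) T) : IsFilling C (Function.update T w C.card) := by
  have hc : (C.erase w).card + 1 = C.card := Finset.card_erase_add_one hw.1
  have key : ∀ u, u ≠ w → Function.update T w C.card u = T u := fun u hu =>
    Function.update_of_ne hu _ _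
  have key' : Function.update T w C.card w = C.card := Function.update_self _ _ _
  have hlt : ∀ u, T u < C.card := fun u => by have := hT.le_card u; omega
  have mono : ∀ u ∈ C, ∀ v ∈ C, u ≠ w → (v ≠ w → T u < T v) →
      Function.update T w C.card u < Function.update T w C.card v := by
    intro u hu v hv huw huv
    rw [key u huw]
    by_cases h : v = w
    · rw [h, key']; exact hlt u
    · rw [key v h]; exact huv h
  refine ⟨⟨fun u hu => ?_, fun u hu v hv h => ?_, fun x hx => ?_⟩, fun u hu => ?_,
    fun u hu v hv h1 h2 => ?_, fun u hu v hv h1 h2 => ?_⟩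
  · refine Finset.mem_coe.mpr (Finset.mem_Icc.mpr ?_)
    by_cases h : u = w
    · rw [h, key']; omega
    · rw [key u h]
      have := Finset.mem_Icc.mp (hT.bijOn.mapsTo (Finset.mem_erase.mpr ⟨h, hu⟩))
      omega
  · by_cases hu' : u = w <;> by_cases hv' : v = w
    · rw [hu', hv']
    · rw [hu', key', key v hv'] at h
      exact absurd h (hlt v).ne'
    · rw [hv', key', key u hu'] at h
      exact absurd h (hlt u).ne
    · rw [key u hu', key v hv'] at h
      exact hT.bijOn.injOn (Finset.mem_erase.mpr ⟨hu', hu⟩) (Finset.mem_erase.mpr ⟨hv', hv⟩) h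
  · have hx' := Finset.mem_Icc.mp hx
    by_cases h : x = C.card
    · exact ⟨w, hw.1, key'.trans h.symm⟩
    · obtain ⟨u, hu, hux⟩ := hT.bijOn.surjOn (Finset.mem_coe.mpr
        (Finset.mem_Icc.mpr (⟨hx'.1, by omega⟩ : 1 ≤ x ∧ x ≤ (C.erase w).card)))
      exact ⟨u, Finset.mem_of_mem_erase hu, (key u (Finset.ne_of_mem_erase hu)).trans hux⟩
  · rw [key u (fun h => hu (h ▸ hw.1))]
    exact hT.eq_zero u fun h => hu (Finset.mem_of_mem_erase h)
  · have huw : u ≠ w := by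
      rintro rfl
      exact absurd ((hw.2 v hv).1 h1.symm) (not_le.mpr h2)
    exact mono u hu v hv huw fun hvw =>
      hT.row u (Finset.mem_erase.mpr ⟨huw, hu⟩) v (Finset.mem_erase.mpr ⟨hvw, hv⟩) h1 h2
  · have huw : u ≠ w := by
      rintro rfl
      exact absurd ((hw.2 v hv).2 h1.symm) (not_le.mpr h2)
    exact mono u hu v hv huw fun hvw =>
      hT.col u (Finset.mem_erase.mpr ⟨huw, hu⟩) v (Finset.mem_erase.mpr ⟨hvw, hv⟩) h1 h2

open Classical in
/-- Branching rule: remove the cell holding the largest entry. -/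
theorem card_standardFilling_eq_sum {C : Finset (ℕ × ℕ)} (hC : C.Nonempty) :
    Nat.card (StandardFilling C) =
      ∑ w ∈ C.filter (IsCorner C), Nat.card (StandardFilling (C.erase w)) := by
  have hpos : 0 < C.card := hC.card_pos
  simp only [card_standardFilling]
  have h : fillings C = (C.filter (IsCorner C)).biUnion fun w =>
      (fillings (C.erase w)).image fun T => Function.update T w C.card := by
    ext T
    simp only [mem_fillings, Finset.mem_biUnion, Finset.mem_filter, Finset.mem_image]
    constructor
    · intro hT
      obtain ⟨w, hw, hTw⟩ := hT.exists_corner hC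
      refine ⟨w, ⟨hw.1, hw⟩, _, hT.erase hw.1 hTw, ?_⟩
      rw [Function.update_idem, ← hTw, Function.update_eq_self]
    · rintro ⟨w, ⟨-, hw⟩, T', hT', rfl⟩
      exact hT'.insert hw
  rw [h, Finset.card_biUnion]
  · refine Finset.sum_congr rfl fun w _ => Finset.card_image_of_injOn fun S hS T hT hST => ?_
    -- The update forgets the value at `w`, but both fillings vanish there, being extended by zero.
    have hS' := (mem_fillings.mp hS).eq_zero w (Finset.notMem_erase w C)
    have hT' := (mem_fillings.mp hT).eq_zero w (Finset.notMem_erase w C)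
    funext u
    by_cases hu : u = w
    · rw [hu, hS', hT']
    · simpa [Function.update_of_ne hu] using congrFun hST u
  · intro w hw v hv hne
    refine Finset.disjoint_left.mpr fun T hT1 hT2 => ?_
    obtain ⟨S1, -, rfl⟩ := Finset.mem_image.mp hT1
    obtain ⟨S2, hS2, hS⟩ := Finset.mem_image.mp hT2
    have h1 := congrFun hS w
    rw [Function.update_self, Function.update_of_ne hne] at h1
    have h2 := (mem_fillings.mp hS2).le_card w
    rw [h1, Finset.card_erase_of_mem (Finset.mem_filter.mp hv).1] at h2
    omega

lemma card_standardFilling_empty : Nat.card (StandardFilling ∅) = 1 := by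
  rw [card_standardFilling, Finset.card_eq_one]
  refine ⟨0, Finset.ext fun T => ?_⟩
  rw [mem_fillings, Finset.mem_singleton]
  constructor
  · exact fun hT => funext fun u => hT.eq_zero u (Finset.notMem_empty u)
  · rintro rfl
    exact ⟨by simp, fun _ _ => rfl, by simp, by simp⟩

/-! ### Determinants of falling factorials -/

/-- The determinant of the falling factorials `(l i)_(a j)`. -/
def fallingDet {N : ℕ} (l a : Fin N → ℕ) : ℚ :=
  (Matrix.of fun i j => ((l i).descFactorial (a j) : ℚ)).det

lemma cast_mul_descFactorial_pred (l a : ℕ) :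
    (l : ℚ) * ((l - 1).descFactorial a : ℚ) = ((l : ℚ) - a) * (l.descFactorial a : ℚ) := by
  rcases l with _ | l
  · rcases a with _ | a <;> simp
  · have h1 := Nat.succ_descFactorial_succ l a
    have h2 := Nat.descFactorial_succ (l + 1) a
    rcases le_or_gt a (l + 1) with h | h
    · have h3 : (((l + 1 - a : ℕ) : ℚ)) = ((l + 1 : ℕ) : ℚ) - a := by rw [Nat.cast_sub h]
      rw [← h3]
      exact_mod_cast h1.symm.trans h2
    · rw [Nat.descFactorial_of_lt (by omega : l + 1 - 1 < a), Nat.descFactorial_of_lt h]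
      simp

/-- The identity holds separately for each permutation in the Leibniz expansion: since l (l-1)_a =
(l - a)(l)_a, lowering one `l i` multiplies the term by `l i - a (σ i)`, and these factors add up to
a sum independent of `σ`. -/
theorem sum_mul_fallingDet_update {N : ℕ} (l a : Fin N → ℕ) :
    ∑ i, (l i : ℚ) * fallingDet (Function.update l i (l i - 1)) a =
      (∑ i, (l i : ℚ) - ∑ j, (a j : ℚ)) * fallingDet l a := by
  simp only [fallingDet, ← Matrix.det_transpose (Matrix.of _), Matrix.det_apply', Finset.mul_sum,
    Matrix.transpose_apply, Matrix.of_apply]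
  rw [Finset.sum_comm]
  refine Finset.sum_congr rfl fun σ _ => ?_
  have key : ∀ i, (l i : ℚ) *
      ∏ x, ((Function.update l i (l i - 1) x).descFactorial (a (σ x)) : ℚ) =
      ((l i : ℚ) - a (σ i)) * ∏ x, ((l x).descFactorial (a (σ x)) : ℚ) := by
    intro i
    rw [← Finset.mul_prod_erase _ _ (Finset.mem_univ i),
      ← Finset.mul_prod_erase _ (fun x => ((l x).descFactorial (a (σ x)) : ℚ))
        (Finset.mem_univ i), Function.update_self, ← mul_assoc, cast_mul_descFactorial_pred,
      mul_assoc]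
    congr 2
    exact Finset.prod_congr rfl fun x hx => by
      rw [Function.update_of_ne (Finset.ne_of_mem_erase hx)]
  simp only [mul_left_comm _ ((Equiv.Perm.sign σ : ℤ) : ℚ), key]
  rw [← Finset.mul_sum, ← Finset.sum_mul, Finset.sum_sub_distrib,
    Equiv.sum_comp σ fun j => (a j : ℚ)]

/-- The strictly decreasing sequence `m i + N - i` attached to row lengths `m 0, …, m N`. -/
def shifted (N : ℕ) (m : ℕ → ℕ) (i : Fin (N + 1)) : ℕ := m i + (N - i)

/-- The shifted sequence of the one-row partition `(k)`. -/
def rowExponents (N k : ℕ) (i : Fin (N + 1)) : ℕ := (if i = 0 then k else 0) + (N - i)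

lemma fallingDet_eq_zero_of_lt {N k : ℕ} {m : ℕ → ℕ} (hm : Antitone m) (h : m 0 < k) :
    fallingDet (shifted N m) (rowExponents N k) = 0 := by
  refine Matrix.det_eq_zero_of_column_eq_zero 0 fun i => ?_
  have := hm (Nat.zero_le (i : ℕ))
  rw [Matrix.of_apply, Nat.descFactorial_of_lt, Nat.cast_zero]
  simp only [shifted, rowExponents, if_true, Fin.val_zero]
  omega

lemma fallingDet_self {N : ℕ} {l : Fin N → ℕ} (hl : StrictAnti l) :
    fallingDet l l = ∏ i, ((l i).factorial : ℚ) := by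
  rw [fallingDet, Matrix.det_of_isUpperTriangular]
  · simp [Nat.descFactorial_self]
  · intro i j hij
    have h : l i < l j := hl hij
    rw [Matrix.of_apply, Nat.descFactorial_of_lt h, Nat.cast_zero]

lemma strictAnti_shifted {N : ℕ} {m : ℕ → ℕ} (hm : Antitone m) : StrictAnti (shifted N m) := by
  intro i j hij
  have h1 := hm (show (i : ℕ) ≤ j from hij.le)
  have h2 : (i : ℕ) < j := hij
  have := j.2
  simp only [shifted]
  omega

/-! ### Removable cells and Aitken's determinant -/

/-- Row `i` of the diagram with row lengths `m 0, …, m N` ends in a removable cell. -/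
def Removable (N : ℕ) (m : ℕ → ℕ) (i : ℕ) : Prop := 0 < m i ∧ (i < N → m (i + 1) < m i)

/-- `C` consists of the cells of the diagram with row lengths `m 0, …, m N`,
without the first `k` cells of the first row. -/
def IsShape (N k : ℕ) (m : ℕ → ℕ) (C : Finset (ℕ × ℕ)) : Prop :=
  ∀ w, w ∈ C ↔ w.1 ≤ N ∧ w.2 < m w.1 ∧ (w.1 = 0 → k ≤ w.2)

/-- Three causes: lowering row 0 to below length `k` makes column 0 vanish; lowering a row as long
as the next makes two matrix rows equal; an empty last row has factor `shifted N m i = 0`. -/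
lemma mul_fallingDet_eq_zero {N k : ℕ} {m : ℕ → ℕ} (hm : Antitone m) (i : Fin (N + 1))
    (hi : ¬ (Removable N m i ∧ ((i : ℕ) = 0 → k < m 0))) :
    (shifted N m i : ℚ) * fallingDet
      (Function.update (shifted N m) i (shifted N m i - 1)) (rowExponents N k) = 0 := by
  have hiN := i.2
  by_cases h1 : Removable N m i
  · have h2 : (i : ℕ) = 0 ∧ m 0 ≤ k := by
      by_contra h
      exact hi ⟨h1, fun h0 => not_le.mp fun hk => h ⟨h0, hk⟩⟩
    refine mul_eq_zero_of_right _ (Matrix.det_eq_zero_of_column_eq_zero 0 fun j => ?_)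
    rw [Matrix.of_apply, Nat.descFactorial_of_lt, Nat.cast_zero]
    have hj := hm (Nat.zero_le (j : ℕ))
    have hp := h1.1
    rw [h2.1] at hp
    by_cases hji : j = i
    · subst hji
      rw [Function.update_self]
      simp only [shifted, rowExponents, if_true, Fin.val_zero, h2.1]
      omega
    · have : (j : ℕ) ≠ i := fun h => hji (Fin.ext h)
      rw [Function.update_of_ne hji]
      simp only [shifted, rowExponents, if_true, Fin.val_zero]
      have := j.2
      omega
  · by_cases h2 : (i : ℕ) < N
    · refine mul_eq_zero_of_right _ ?_
      have h3 : m (i + 1) = m i := by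
        by_contra h
        have := hm (Nat.le_succ (i : ℕ))
        rw [Nat.succ_eq_add_one] at this
        exact h1 ⟨by omega, fun _ => by omega⟩
      have hne : i ≠ ⟨i + 1, by omega⟩ := fun h => by
        have := congrArg Fin.val h
        simp at this
      refine Matrix.det_zero_of_row_eq hne (funext fun j => ?_)
      rw [Matrix.of_apply, Matrix.of_apply, Function.update_self,
        Function.update_of_ne (Ne.symm hne)]
      simp only [shifted, h3]
      congr 2
      omega
    · have h3 : m i = 0 := by
        by_contra h
        exact h1 ⟨by omega, fun h' => absurd h' h2⟩
      have : shifted N m i = 0 := by simp only [shifted]; omega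
      simp [this]

lemma shifted_update {N : ℕ} {m : ℕ → ℕ} (i : Fin (N + 1)) (hi : 0 < m i) :
    shifted N (Function.update m i (m i - 1)) =
      Function.update (shifted N m) i (shifted N m i - 1) := by
  funext j
  by_cases h : j = i
  · subst h
    simp only [shifted, Function.update_self]
    omega
  · have h' : (j : ℕ) ≠ i := fun h' => h (Fin.ext h')
    simp only [shifted, Function.update_of_ne h, Function.update_of_ne h']

lemma prod_factorial_shifted {N : ℕ} {m : ℕ → ℕ} (i : Fin (N + 1)) (hi : 0 < m i) :
    ∏ j, ((shifted N m j).factorial : ℚ) = (shifted N m i : ℚ) *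
      ∏ j, ((shifted N (Function.update m i (m i - 1)) j).factorial : ℚ) := by
  rw [shifted_update i hi, ← Finset.mul_prod_erase _ _ (Finset.mem_univ i),
    ← Finset.mul_prod_erase _ (fun j => ((Function.update (shifted N m) i
      (shifted N m i - 1) j).factorial : ℚ)) (Finset.mem_univ i), Function.update_self, ← mul_assoc]
  have h : shifted N m i ≠ 0 := by simp only [shifted]; omega
  congr 1
  · exact_mod_cast (Nat.mul_factorial_pred h).symm
  · exact Finset.prod_congr rfl fun x hx => by
      rw [Function.update_of_ne (Finset.ne_of_mem_erase hx)]

lemma IsShape.erase {N k : ℕ} {m : ℕ → ℕ} {C : Finset (ℕ × ℕ)} (hC : IsShape N k m C)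
    {i : ℕ} (hi : 0 < m i) :
    IsShape N k (Function.update m i (m i - 1)) (C.erase (i, m i - 1)) := by
  rintro ⟨a, b⟩
  rw [Finset.mem_erase, hC]
  by_cases h : a = i
  · subst h
    simp only [Function.update_self, ne_eq, Prod.mk.injEq, true_and]
    omega
  · simp [h]

lemma antitone_update_of_removable {N : ℕ} {m : ℕ → ℕ} (hm : Antitone m)
    (hN : ∀ i, N < i → m i = 0) {i : ℕ} (hi : Removable N m i) (hiN : i ≤ N) :
    Antitone (Function.update m i (m i - 1)) := by
  refine antitone_nat_of_succ_le fun j => ?_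
  have h1 := hm (Nat.le_succ j)
  rw [Nat.succ_eq_add_one] at h1
  by_cases hj : j = i
  · subst hj
    rw [Function.update_self, Function.update_of_ne (by omega)]
    rcases lt_or_eq_of_le hiN with h | h
    · have := hi.2 h
      omega
    · rw [hN (j + 1) (by omega)]
      exact Nat.zero_le _
  · rw [Function.update_of_ne hj]
    by_cases hj' : j + 1 = i
    · rw [hj', Function.update_self, ← hj']
      omega
    · rwa [Function.update_of_ne hj']

lemma IsShape.isCorner_iff {N k : ℕ} {m : ℕ → ℕ} {C : Finset (ℕ × ℕ)} (hC : IsShape N k m C)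
    (hm : Antitone m) (w : ℕ × ℕ) : IsCorner C w ↔
      w.1 ≤ N ∧ w.2 = m w.1 - 1 ∧ Removable N m w.1 ∧ (w.1 = 0 → k < m 0) := by
  obtain ⟨i, j⟩ := w
  constructor
  · rintro ⟨h1, h2⟩
    obtain ⟨hi, hj, hk⟩ := (hC _).mp h1
    dsimp only at hi hj hk ⊢
    have h3 := (h2 (i, m i - 1) ((hC _).mpr ⟨hi, by dsimp only; omega, fun h => by
      have := hk h
      dsimp only
      omega⟩)).1 rfl
    dsimp only at h3
    refine ⟨hi, by omega, ⟨by omega, fun hiN => ?_⟩, fun h => ?_⟩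
    · by_contra! hlt
      have := (h2 (i + 1, j) ((hC _).mpr ⟨by dsimp only; omega, by dsimp only; omega,
        fun h => absurd h (Nat.succ_ne_zero i)⟩)).2 rfl
      dsimp only at this
      omega
    · subst h
      have := hk rfl
      omega
  · rintro ⟨hi, hj, ⟨hp, hr⟩, hk⟩
    dsimp only at hi hj hp hr hk
    refine ⟨(hC _).mpr ⟨hi, by dsimp only; omega, fun h => ?_⟩, ?_⟩
    · dsimp only at h ⊢
      subst h
      have := hk rfl
      omega
    · rintro ⟨a, b⟩ hab
      obtain ⟨ha, hb, -⟩ := (hC _).mp hab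
      dsimp only at ha hb ⊢
      refine ⟨fun h => ?_, fun h => ?_⟩
      · subst h
        omega
      · by_contra! hlt
        have h1 := hm (show i + 1 ≤ a from hlt)
        have h2 := hr (by omega)
        omega

open Classical in
lemma IsShape.sum_corners {N k : ℕ} {m : ℕ → ℕ} {C : Finset (ℕ × ℕ)} (hC : IsShape N k m C)
    (hm : Antitone m) (f : ℕ × ℕ → ℕ) :
    ∑ w ∈ C.filter (IsCorner C), f w =
      ∑ i : Fin (N + 1), if Removable N m i ∧ ((i : ℕ) = 0 → k < m 0) then f (i, m i - 1) else 0 := by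
  rw [← Finset.sum_filter]
  refine Finset.sum_bij' (fun w hw => (⟨w.1, Nat.lt_succ_of_le
      ((hC.isCorner_iff hm w).mp (Finset.mem_filter.mp hw).2).1⟩ : Fin (N + 1)))
    (fun i _ => ((i : ℕ), m i - 1)) (fun w hw => ?_) (fun i hi => ?_) (fun w hw => ?_)
    (fun i hi => rfl) (fun w hw => ?_)
  · exact Finset.mem_filter.mpr ⟨Finset.mem_univ _,
      ((hC.isCorner_iff hm w).mp (Finset.mem_filter.mp hw).2).2.2⟩
  · have h : IsCorner C ((i : ℕ), m i - 1) := (hC.isCorner_iff hm _).mpr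
      ⟨Nat.le_of_lt_succ i.2, rfl, (Finset.mem_filter.mp hi).2⟩
    exact Finset.mem_filter.mpr ⟨h.1, h⟩
  · exact Prod.ext rfl ((hC.isCorner_iff hm w).mp (Finset.mem_filter.mp hw).2).2.1.symm
  · congr 1
    exact Prod.ext rfl ((hC.isCorner_iff hm w).mp (Finset.mem_filter.mp hw).2).2.1

/-- Aitken's determinant for the number of fillings of `lam / (k)`. -/
theorem card_standardFilling_mul_prod_factorial {N k : ℕ} (s : ℕ) {m : ℕ → ℕ} (hm : Antitone m)
    (hN : ∀ i, N < i → m i = 0) (hk : k ≤ m 0) (hs : ∑ i : Fin (N + 1), m i = s + k)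
    {C : Finset (ℕ × ℕ)} (hC : IsShape N k m C) :
    (Nat.card (StandardFilling C) : ℚ) * ∏ i, ((shifted N m i).factorial : ℚ) =
      s.factorial * fallingDet (shifted N m) (rowExponents N k) := by
  classical
  induction s generalizing m C with
  | zero =>
    rw [Fin.sum_univ_succ, Fin.val_zero, zero_add] at hs
    have h0 : m 0 = k := by omega
    have h1 : ∀ i : Fin N, m (i.succ : Fin (N + 1)) = 0 := fun i =>
      (Finset.sum_eq_zero_iff.mp (by omega : ∑ i : Fin N, m (i.succ : Fin (N + 1)) = 0)) i
        (Finset.mem_univ i)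
    -- Only the shape `(k)` itself is left, so the matrix is triangular with diagonal l_i!.
    have hl : shifted N m = rowExponents N k := by
      funext i
      induction i using Fin.cases with
      | zero => simp [shifted, rowExponents, h0]
      | succ i => simp only [shifted, rowExponents, h1, Fin.succ_ne_zero, if_false]
    have hCe : C = ∅ := by
      refine Finset.eq_empty_of_forall_notMem fun ⟨a, b⟩ hw => ?_
      obtain ⟨ha, hb, hb0⟩ := (hC _).mp hw
      dsimp only at ha hb hb0
      rcases a with _ | a
      · have := hb0 rfl
        omega
      · have := h1 ⟨a, by omega⟩
        simp only [Fin.succ_mk] at this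
        omega
    subst hCe
    rw [card_standardFilling_empty, ← hl, fallingDet_self (strictAnti_shifted hm)]
    simp
  | succ s ih =>
    have hne : C.Nonempty := by
      by_contra hemp
      rw [Finset.not_nonempty_iff_eq_empty] at hemp
      subst hemp
      have h0 : m 0 = k := by
        by_contra h
        exact absurd ((hC (0, k)).mpr ⟨Nat.zero_le _, by dsimp only; omega, fun _ => le_rfl⟩)
          (Finset.notMem_empty _)
      have h1 : ∀ i : Fin N, m (i.succ : Fin (N + 1)) = 0 := fun i => by
        by_contra h
        exact absurd ((hC ((i.succ : Fin (N + 1)), 0)).mpr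
          ⟨Nat.le_of_lt_succ i.succ.2, Nat.pos_of_ne_zero h, fun h => by simp at h⟩)
          (Finset.notMem_empty _)
      rw [Fin.sum_univ_succ, Fin.val_zero, h0] at hs
      simp only [h1, Finset.sum_const_zero] at hs
      omega
    have hD := sum_mul_fallingDet_update (shifted N m) (rowExponents N k)
    -- The staircase terms `N - i` cancel, leaving the number of cells of the skew shape.
    have hsum : ∑ i, (shifted N m i : ℚ) - ∑ j, (rowExponents N k j : ℚ) = s + 1 := by
      have h1 : ∑ i, shifted N m i = s + 1 + ∑ j, rowExponents N k j := by
        simp only [shifted, rowExponents, Finset.sum_add_distrib, hs, Finset.sum_ite_eq',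
          Finset.mem_univ, if_true]
        ring
      have h2 : (∑ i, (shifted N m i : ℚ)) = s + 1 + ∑ j, (rowExponents N k j : ℚ) := by
        exact_mod_cast h1
      rw [h2]
      ring
    rw [hsum] at hD
    rw [card_standardFilling_eq_sum hne, hC.sum_corners hm, Nat.cast_sum, Finset.sum_mul,
      Nat.factorial_succ, Nat.cast_mul, Nat.cast_succ, mul_comm ((s : ℚ) + 1), mul_assoc, ← hD,
      Finset.mul_sum]
    refine Finset.sum_congr rfl fun i _ => ?_
    by_cases hi : Removable N m i ∧ ((i : ℕ) = 0 → k < m 0)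
    · rw [if_pos hi, prod_factorial_shifted i hi.1.1, mul_left_comm, mul_left_comm (s.factorial : ℚ),
        ← shifted_update i hi.1.1]
      congr 1
      refine ih (antitone_update_of_removable hm hN hi.1 (Nat.le_of_lt_succ i.2)) (fun j hj => ?_) ?_
        ?_ (hC.erase hi.1.1)
      · have := i.2
        rw [Function.update_of_ne (by omega)]
        exact hN j hj
      · by_cases h : 0 = (i : ℕ)
        · rw [← h, Function.update_self]
          have := hi.2 h.symm
          omega
        · rwa [Function.update_of_ne h]
      · have h1 : ∑ j : Fin (N + 1), Function.update m i (m i - 1) j + 1 =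
            ∑ j : Fin (N + 1), m j := by
          rw [← Finset.add_sum_erase _ _ (Finset.mem_univ i),
            ← Finset.add_sum_erase _ (fun j : Fin (N + 1) => m j) (Finset.mem_univ i),
            Function.update_self]
          have h2 : ∑ x ∈ Finset.univ.erase i, Function.update m i (m i - 1) x =
              ∑ x ∈ Finset.univ.erase i, m x :=
            Finset.sum_congr rfl fun x hx => Function.update_of_ne
              (fun h => Finset.ne_of_mem_erase hx (Fin.ext h)) _ _
          rw [h2]
          have := hi.1.1
          omega
        omega
    · rw [if_neg hi, mul_fallingDet_eq_zero hm i hi]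
      simp

/-! ### Expansion of the content product -/

/-- Coefficients at `u⁻¹, …, u⁻⁴` of `∏ (u - c) / (u - c - 1)`, in the power sums of the `c`. -/
def g1 (s : ℕ → ℚ) : ℚ := s 0

/-- The logarithm of the product is the sum over k of u^-k ∑ ((c+1)^k - c^k)/k; the brackets here
and below are these binomial differences, and exponentiating gives the formulas. -/
def g2 (s : ℕ → ℚ) : ℚ := s 0 ^ 2 / 2 + (2 * s 1 + s 0) / 2

def g3 (s : ℕ → ℚ) : ℚ :=
  s 0 ^ 3 / 6 + s 0 * (2 * s 1 + s 0) / 2 + (3 * s 2 + 3 * s 1 + s 0) / 3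

def g4 (s : ℕ → ℚ) : ℚ :=
  s 0 ^ 4 / 24 + s 0 ^ 2 * (2 * s 1 + s 0) / 4 + (2 * s 1 + s 0) ^ 2 / 8 +
    s 0 * (3 * s 2 + 3 * s 1 + s 0) / 3 + (4 * s 3 + 6 * s 2 + 4 * s 1 + s 0) / 4

/-- The quartic part of the series with these coefficients. -/
noncomputable def quartic (s : ℕ → ℚ) : ℚ[X] :=
  X ^ 4 + C (g1 s) * X ^ 3 + C (g2 s) * X ^ 2 + C (g3 s) * X + C (g4 s)

/-- A new cell of content `c` multiplies the series by (u - c)/(u - c - 1). Truncation spoils only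
the constant term, whence `d`. -/
lemma quartic_step (s : ℕ → ℚ) (c : ℚ) :
    ∃ d : ℚ, quartic (fun r => s r + c ^ r) * (X - C (c + 1)) = quartic s * (X - C c) + C d := by
  refine ⟨c * g4 s - (c + 1) * g4 (fun r => s r + c ^ r), ?_⟩
  have h1 : g1 (fun r => s r + c ^ r) = g1 s + 1 := by simp [g1]
  have h2 : g2 (fun r => s r + c ^ r) = (c + 1) * g1 (fun r => s r + c ^ r) + g2 s - c * g1 s := by
    simp only [g1, g2]; ring
  have h3 : g3 (fun r => s r + c ^ r) = (c + 1) * g2 (fun r => s r + c ^ r) + g3 s - c * g2 s := by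
    simp only [g2, g3]; ring
  have h4 : g4 (fun r => s r + c ^ r) = (c + 1) * g3 (fun r => s r + c ^ r) + g4 s - c * g3 s := by
    simp only [g3, g4]; ring
  simp only [quartic]
  rw [h4, h3, h2, h1]
  simp only [C_add, C_sub, C_mul, C_1]
  ring

/-- `A / Φ` agrees with `∏ (u - c) / (u - c - 1)` to order `u⁻⁴`, for `Φ` of degree `n`. -/
def Approx (n : ℕ) (A Φ : ℚ[X]) (s : ℕ → ℚ) : Prop := (X ^ 4 * A - quartic s * Φ).degree < (n : WithBot ℕ)

/-- Adding a cell of content `c` at the end of a row moves one root of Φ from `c` to `c + 1`; the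
error `d * Ψ` is of too low a degree to matter. -/
lemma Approx.step {n : ℕ} {A Ψ : ℚ[X]} {s : ℕ → ℚ} {c : ℚ} (hΨ : Ψ.degree < (n : WithBot ℕ))
    (h : Approx n A ((X - C c) * Ψ) s) :
    Approx n A ((X - C (c + 1)) * Ψ) (fun r => s r + c ^ r) := by
  obtain ⟨d, hd⟩ := quartic_step s c
  have : X ^ 4 * A - quartic (fun r => s r + c ^ r) * ((X - C (c + 1)) * Ψ) =
      (X ^ 4 * A - quartic s * ((X - C c) * Ψ)) - C d * Ψ := by
    rw [← mul_assoc, hd]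
    ring
  rw [Approx, this]
  refine (degree_sub_le _ _).trans_lt (max_lt h ?_)
  exact (C_mul' d Ψ ▸ degree_smul_le d Ψ).trans_lt hΨ

lemma Approx.row {n : ℕ} {A Ψ : ℚ[X]} {s : ℕ → ℚ} {c : ℚ} (hΨ : Ψ.degree < (n : WithBot ℕ))
    (h : Approx n A ((X - C c) * Ψ) s) (p : ℕ) :
    Approx n A ((X - C (c + p)) * Ψ) (fun r => s r + ∑ j ∈ range p, (c + j) ^ r) := by
  induction p with
  | zero => simpa using h
  | succ p ih =>
    have := ih.step hΨ
    simp only [Finset.sum_range_succ, ← add_assoc, Nat.cast_succ]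
    exact this

/-- Content power sums of the diagram with row lengths `m 0, …, m (K - 1)`. -/
def contentSum (m : ℕ → ℕ) (K r : ℕ) : ℚ :=
  ∑ i ∈ range K, ∑ j ∈ range (m i), (-(i : ℚ) + j) ^ r

/-- The polynomial with roots `m i - i` for `i < K`. -/
noncomputable def rowPoly (m : ℕ → ℕ) (K : ℕ) : ℚ[X] :=
  ∏ i ∈ range K, (X - C (-(i : ℚ) + m i))

lemma monic_rowPoly (m : ℕ → ℕ) (K : ℕ) : (rowPoly m K).Monic :=
  monic_prod_of_monic _ _ fun _ _ => monic_X_sub_C _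

lemma natDegree_rowPoly (m : ℕ → ℕ) (K : ℕ) : (rowPoly m K).natDegree = K := by
  rw [rowPoly, natDegree_prod_of_monic _ _ fun _ _ => monic_X_sub_C _]
  simp only [natDegree_X_sub_C, Finset.sum_const, Finset.card_range, smul_eq_mul, mul_one]

lemma approx_rowPoly (m : ℕ → ℕ) (K : ℕ) :
    Approx K (rowPoly (fun _ => 0) K) (rowPoly m K) (contentSum m K) := by
  induction K with
  | zero => simp [Approx, rowPoly, contentSum, quartic, g1, g2, g3, g4]
  | succ K ih =>
    -- The new row starts empty: both sides gain the same factor X + K. Its cells are then added by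
    -- `Approx.row`.
    have h1 : Approx (K + 1) (rowPoly (fun _ => 0) (K + 1)) ((X - C (-(K : ℚ))) * rowPoly m K)
        (contentSum m K) := by
      have : X ^ 4 * rowPoly (fun _ => 0) (K + 1) -
          quartic (contentSum m K) * ((X - C (-(K : ℚ))) * rowPoly m K) =
          (X ^ 4 * rowPoly (fun _ => 0) K - quartic (contentSum m K) * rowPoly m K) *
            (X - C (-(K : ℚ))) := by
        simp only [rowPoly, Finset.prod_range_succ, Nat.cast_zero, add_zero]
        ring
      rw [Approx, this, degree_mul, degree_X_sub_C]
      have h := ih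
      rw [Approx] at h
      push_cast
      exact WithBot.add_lt_add_right (by simp) h
    have h2 := h1.row (by
      rw [degree_eq_natDegree (monic_rowPoly m K).ne_zero, natDegree_rowPoly]
      exact_mod_cast Nat.lt_succ_self K) (m K)
    have h3 : rowPoly m (K + 1) = (X - C (-(K : ℚ) + m K)) * rowPoly m K := by
      rw [rowPoly, Finset.prod_range_succ, mul_comm]; rfl
    have h4 : contentSum m (K + 1) =
        fun r => contentSum m K r + ∑ j ∈ range (m K), (-(K : ℚ) + j) ^ r := by
      funext r
      rw [contentSum, Finset.sum_range_succ]; rfl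
    rw [h3, h4]
    exact_mod_cast h2

/-! ### The remainder modulo Φ -/

/-- The content polynomial for the one-row shape `(4)`. -/
def rowFour (s : ℕ → ℚ) : ℚ := g4 s - 6 * g3 s + 11 * g2 s - 6 * g1 s

/-- Shortens the expansion of A/Φ by one order, reading off the dropped coefficient as the
coefficient of `p` just below the degree of Φ. -/
lemma degree_lt_of_X_mul {n : ℕ} {p q Φ : ℚ[X]} {g : ℚ} (hΦ : Φ.Monic) (hn : Φ.natDegree = n + 1)
    (h : X * p = q + C g * Φ) (hq : q.degree < ((n + 1 : ℕ) : WithBot ℕ)) :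
    p.degree < ((n + 1 : ℕ) : WithBot ℕ) ∧ p.coeff n = g := by
  have hc : ∀ j, n ≤ j → p.coeff j = if j = n then g else 0 := by
    intro j hj
    have h1 := congrArg (fun f => coeff f (j + 1)) h
    simp only [coeff_X_mul, coeff_add, coeff_C_mul] at h1
    rw [h1, coeff_eq_zero_of_degree_lt (hq.trans_le (by exact_mod_cast Nat.succ_le_succ hj))]
    split_ifs with hjn
    · subst hjn
      rw [← hn, hΦ.coeff_natDegree]
      ring
    · rw [coeff_eq_zero_of_natDegree_lt (p := Φ) (by omega)]
      ring
  refine ⟨(degree_lt_iff_coeff_zero _ _).mpr fun j hj => ?_, by simpa using hc n le_rfl⟩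
  rw [hc j (by omega), if_neg (by omega)]

lemma Approx.exists_remainder {n : ℕ} {A Φ : ℚ[X]} {s : ℕ → ℚ} (hΦ : Φ.Monic)
    (hn : Φ.natDegree = n + 1) (h : Approx (n + 1) A Φ s) :
    ∃ Q R : ℚ[X], A * ((X - C 1) * (X - C 2) * (X - C 3)) = Q * Φ + R ∧
      R.natDegree ≤ n ∧ R.coeff n = rowFour s := by
  have e3 : X * (X ^ 3 * A - (X ^ 3 + C (g1 s) * X ^ 2 + C (g2 s) * X + C (g3 s)) * Φ) =
      (X ^ 4 * A - quartic s * Φ) + C (g4 s) * Φ := by rw [quartic]; ring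
  obtain ⟨d3, c3⟩ := degree_lt_of_X_mul hΦ hn e3 h
  have e2 : X * (X ^ 2 * A - (X ^ 2 + C (g1 s) * X + C (g2 s)) * Φ) =
      (X ^ 3 * A - (X ^ 3 + C (g1 s) * X ^ 2 + C (g2 s) * X + C (g3 s)) * Φ) + C (g3 s) * Φ := by
    ring
  obtain ⟨d2, c2⟩ := degree_lt_of_X_mul hΦ hn e2 d3
  have e1 : X * (X * A - (X + C (g1 s)) * Φ) =
      (X ^ 2 * A - (X ^ 2 + C (g1 s) * X + C (g2 s)) * Φ) + C (g2 s) * Φ := by ring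
  obtain ⟨d1, c1⟩ := degree_lt_of_X_mul hΦ hn e1 d2
  have e0 : X * (A - Φ) = (X * A - (X + C (g1 s)) * Φ) + C (g1 s) * Φ := by ring
  obtain ⟨d0, c0⟩ := degree_lt_of_X_mul hΦ hn e0 d1
  set R3 := X ^ 3 * A - (X ^ 3 + C (g1 s) * X ^ 2 + C (g2 s) * X + C (g3 s)) * Φ with hR3
  set R2 := X ^ 2 * A - (X ^ 2 + C (g1 s) * X + C (g2 s)) * Φ with hR2
  set R1 := X * A - (X + C (g1 s)) * Φ with hR1
  set R0 := A - Φ with hR0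
  -- The weights 1, -6, 11, -6 are the coefficients of (X - 1)(X - 2)(X - 3).
  refine ⟨(X ^ 3 + C (g1 s) * X ^ 2 + C (g2 s) * X + C (g3 s)) -
      C 6 * (X ^ 2 + C (g1 s) * X + C (g2 s)) + C 11 * (X + C (g1 s)) - C 6,
    R3 - C 6 * R2 + C 11 * R1 - C 6 * R0, ?_, ?_, ?_⟩
  · have h2 : (C 2 : ℚ[X]) = 2 := rfl
    have h3 : (C 3 : ℚ[X]) = 3 := rfl
    have h6 : (C 6 : ℚ[X]) = 6 := rfl
    have h11 : (C 11 : ℚ[X]) = 11 := rfl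
    rw [hR3, hR2, hR1, hR0, h2, h3, h6, h11, C_1]
    ring
  · refine natDegree_le_iff_degree_le.mpr (degree_le_iff_coeff_zero _ _ |>.mpr fun j hj => ?_)
    have hj' : ((n + 1 : ℕ) : WithBot ℕ) ≤ j := by exact_mod_cast hj
    simp only [coeff_add, coeff_sub, coeff_C_mul,
      coeff_eq_zero_of_degree_lt (d0.trans_le hj'), coeff_eq_zero_of_degree_lt (d1.trans_le hj'),
      coeff_eq_zero_of_degree_lt (d2.trans_le hj'), coeff_eq_zero_of_degree_lt (d3.trans_le hj')]
    ring
  · simp only [coeff_add, coeff_sub, coeff_C_mul, c0, c1, c2, c3]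
    rfl

/-! ### Reduction to the Vandermonde determinant -/

/-- The change of basis from powers of X is triangular, with every diagonal entry 1 except possibly
the last. -/
lemma det_eval_eq_coeff_mul {N : ℕ} (v : Fin (N + 1) → ℚ) (p : Fin (N + 1) → ℚ[X])
    (hdeg : ∀ j, (p j).natDegree ≤ j) (hmonic : ∀ j : Fin N, (p j.castSucc).coeff j = 1) :
    (Matrix.of fun i j => (p j).eval (v i)).det =
      (p (Fin.last N)).coeff N * (Matrix.vandermonde v).det := by
  rw [Matrix.eval_matrixOfPolynomials_eq_vandermonde_mul_matrixOfPolynomials v p hdeg,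
    Matrix.det_mul, mul_comm]
  congr 1
  rw [Matrix.det_of_isUpperTriangular]
  · rw [Fin.prod_univ_castSucc]
    simp only [Matrix.of_apply, Fin.val_castSucc, hmonic, Finset.prod_const_one, one_mul,
      Fin.val_last]
  · intro i j hij
    have h : j < i := hij
    rw [Matrix.of_apply, coeff_eq_zero_of_natDegree_lt ((hdeg j).trans_lt h)]

lemma cast_descFactorial_eq_prod (l j : ℕ) :
    (l.descFactorial j : ℚ) = ∏ t ∈ range j, ((l : ℚ) - t) := by
  induction j with
  | zero => simp
  | succ j ih =>
    rw [Finset.prod_range_succ, ← ih, Nat.descFactorial_succ, Nat.cast_mul, mul_comm]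
    rcases le_or_gt j l with h | h
    · rw [Nat.cast_sub h]
    · rw [Nat.descFactorial_of_lt h]
      simp

/-- The falling factorial `(u + N)_j`, as a polynomial in `u`. -/
noncomputable def fallingPoly (N j : ℕ) : ℚ[X] := ∏ t ∈ range j, (X - C ((t : ℚ) - N))

lemma monic_fallingPoly (N j : ℕ) : (fallingPoly N j).Monic :=
  monic_prod_of_monic _ _ fun _ _ => monic_X_sub_C _

lemma natDegree_fallingPoly (N j : ℕ) : (fallingPoly N j).natDegree = j := by
  rw [fallingPoly, natDegree_prod_of_monic _ _ fun _ _ => monic_X_sub_C _]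
  simp only [natDegree_X_sub_C, Finset.sum_const, Finset.card_range, smul_eq_mul, mul_one]

lemma coeff_fallingPoly (N j : ℕ) : (fallingPoly N j).coeff j = 1 := by
  have := (monic_fallingPoly N j).coeff_natDegree
  rwa [natDegree_fallingPoly] at this

lemma cast_shifted {N : ℕ} (m : ℕ → ℕ) (i : Fin (N + 1)) :
    (shifted N m i : ℚ) = -(i : ℚ) + m i + N := by
  rw [shifted, Nat.cast_add, Nat.cast_sub (Nat.le_of_lt_succ i.2)]
  ring

lemma eval_fallingPoly {N : ℕ} (m : ℕ → ℕ) (i : Fin (N + 1)) (j : ℕ) :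
    (fallingPoly N j).eval (-(i : ℚ) + m i) = ((shifted N m i).descFactorial j : ℚ) := by
  rw [cast_descFactorial_eq_prod, fallingPoly, eval_prod]
  refine Finset.prod_congr rfl fun t _ => ?_
  rw [eval_sub, eval_X, eval_C, cast_shifted]
  ring

lemma rowPoly_zero (N : ℕ) : rowPoly (fun _ => 0) (N + 1) = fallingPoly N (N + 1) := by
  rw [rowPoly, fallingPoly, ← Finset.prod_range_reflect]
  refine Finset.prod_congr rfl fun t ht => ?_
  have h : t ≤ N := Nat.le_of_lt_succ (Finset.mem_range.mp ht)
  rw [Nat.add_sub_cancel, Nat.cast_sub h]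
  congr 2
  simp

lemma eval_fallingPoly_add_four {N : ℕ} (m : ℕ → ℕ) (i : Fin (N + 1)) :
    (rowPoly (fun _ => 0) (N + 1) * ((X - C 1) * (X - C 2) * (X - C 3))).eval (-(i : ℚ) + m i) =
      ((shifted N m i).descFactorial (N + 4) : ℚ) := by
  rw [rowPoly_zero, eval_mul, eval_fallingPoly, cast_descFactorial_eq_prod,
    cast_descFactorial_eq_prod, Finset.prod_range_succ _ (N + 3), Finset.prod_range_succ _ (N + 2),
    Finset.prod_range_succ _ (N + 1), cast_shifted]
  simp only [eval_mul, eval_sub, eval_X, eval_C]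
  push_cast
  ring

lemma eval_rowPoly {N : ℕ} (m : ℕ → ℕ) (i : Fin (N + 1)) :
    (rowPoly m (N + 1)).eval (-(i : ℚ) + m i) = 0 := by
  rw [rowPoly, eval_prod]
  exact Finset.prod_eq_zero (Finset.mem_range.mpr i.2) (by simp)

/-- Puts the exponents in increasing order, as the Vandermonde matrix needs. The sign does not
depend on `k`, so it cancels in D_4 / D_0. -/
lemma fallingDet_rev {N : ℕ} (l a : Fin N → ℕ) : fallingDet l a =
    ((Equiv.Perm.sign (Fin.revPerm : Equiv.Perm (Fin N)) : ℤ) : ℚ) *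
      (Matrix.of fun i j => ((l i).descFactorial (a (Fin.rev j)) : ℚ)).det := by
  have h := Matrix.det_permute' Fin.revPerm
    (Matrix.of fun i j => ((l i).descFactorial (a (Fin.rev j)) : ℚ))
  rw [← h, fallingDet]
  congr 1
  ext i j
  simp

lemma rowExponents_rev_castSucc {N k : ℕ} (j : Fin N) :
    rowExponents N k (Fin.rev j.castSucc) = j := by
  have := j.2
  rw [rowExponents, Fin.rev_castSucc, if_neg (Fin.succ_ne_zero _)]
  simp only [Fin.val_succ, Fin.val_rev]
  omega

lemma rowExponents_rev_last {N k : ℕ} : rowExponents N k (Fin.rev (Fin.last N)) = N + k := by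
  simp [rowExponents, add_comm]

lemma fallingDet_rowExponents_zero (N : ℕ) (m : ℕ → ℕ) :
    fallingDet (shifted N m) (rowExponents N 0) =
      ((Equiv.Perm.sign (Fin.revPerm : Equiv.Perm (Fin (N + 1))) : ℤ) : ℚ) *
        (Matrix.vandermonde fun i : Fin (N + 1) => -(i : ℚ) + m i).det := by
  rw [fallingDet_rev]
  have h := det_eval_eq_coeff_mul (fun i : Fin (N + 1) => -(i : ℚ) + m i)
    (fun j => fallingPoly N j) (fun j => (natDegree_fallingPoly N j).le)
    fun j => coeff_fallingPoly N j
  rw [Fin.val_last, coeff_fallingPoly, one_mul] at h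
  rw [← h]
  congr 2
  ext i j
  rw [Matrix.of_apply, Matrix.of_apply, eval_fallingPoly]
  induction j using Fin.lastCases with
  | last => rw [rowExponents_rev_last]; rfl
  | cast j => rw [rowExponents_rev_castSucc]; rfl

lemma fallingDet_rowExponents_zero_ne_zero {N : ℕ} {m : ℕ → ℕ} (hm : Antitone m) :
    fallingDet (shifted N m) (rowExponents N 0) ≠ 0 := by
  rw [fallingDet_rowExponents_zero]
  refine mul_ne_zero ?_ (Matrix.det_vandermonde_ne_zero_iff.mpr fun i j hij => ?_)
  · exact_mod_cast (Equiv.Perm.sign _).ne_zero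
  · refine (strictAnti_shifted (N := N) hm).injective ?_
    have : (shifted N m i : ℚ) = shifted N m j := by
      rw [cast_shifted, cast_shifted]
      exact congrArg (· + (N : ℚ)) hij
    exact_mod_cast this

theorem fallingDet_rowExponents_four (N : ℕ) (m : ℕ → ℕ) :
    fallingDet (shifted N m) (rowExponents N 4) =
      rowFour (contentSum m (N + 1)) * fallingDet (shifted N m) (rowExponents N 0) := by
  obtain ⟨Q, R, hQR, hdeg, hcoeff⟩ := (approx_rowPoly m (N + 1)).exists_remainder
    (monic_rowPoly m _) (natDegree_rowPoly m _)
  have h := det_eval_eq_coeff_mul (fun i : Fin (N + 1) => -(i : ℚ) + m i)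
    -- The remainder `R` may replace the degree `N + 4` polynomial because Φ vanishes at all
    -- evaluation points.
    (Fin.lastCases R fun j => fallingPoly N j) (fun j => by
      induction j using Fin.lastCases with
      | last => simpa using hdeg
      | cast j => simpa using (natDegree_fallingPoly N j).le)
    fun j => by simpa using coeff_fallingPoly N j
  rw [Fin.lastCases_last, hcoeff] at h
  rw [fallingDet_rowExponents_zero, fallingDet_rev, mul_left_comm, ← h]
  congr 2
  ext i j
  rw [Matrix.of_apply, Matrix.of_apply]
  induction j using Fin.lastCases with
  | last =>
    rw [rowExponents_rev_last, Fin.lastCases_last, ← eval_fallingPoly_add_four, hQR, eval_add,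
      eval_mul, eval_rowPoly]
    ring
  | cast j => rw [rowExponents_rev_castSucc, Fin.lastCases_castSucc, eval_fallingPoly]

/-! ### Young diagrams and the final ratio -/

lemma mem_oneRow {k : ℕ} {w : ℕ × ℕ} : w ∈ (oneRow k).cells ↔ w.1 = 0 ∧ w.2 < k := by
  rw [YoungDiagram.mem_cells, oneRow, YoungDiagram.mem_ofRowLens]
  obtain ⟨i, j⟩ := w
  rcases i with _ | i <;> simp

lemma oneRow_le_iff {k : ℕ} {lam : YoungDiagram} : oneRow k ≤ lam ↔ k ≤ lam.rowLen 0 := by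
  rw [← YoungDiagram.cells_subset_iff]
  constructor
  · intro h
    by_contra! hlt
    have h1 : (0, lam.rowLen 0) ∈ lam.cells := h (mem_oneRow.mpr ⟨rfl, hlt⟩)
    exact lt_irrefl _ (YoungDiagram.mem_iff_lt_rowLen.mp h1)
  · rintro h ⟨i, j⟩ hw
    obtain ⟨h1, h2⟩ := mem_oneRow.mp hw
    dsimp only at h1 h2
    subst h1
    exact YoungDiagram.mem_iff_lt_rowLen.mpr (h2.trans_le h)

lemma rowLen_eq_zero {lam : YoungDiagram} {i : ℕ} (h : lam.colLen 0 < i) : lam.rowLen i = 0 := by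
  by_contra hne
  have h1 : (i, 0) ∈ lam := YoungDiagram.mem_iff_lt_rowLen.mpr (Nat.pos_of_ne_zero hne)
  have := YoungDiagram.mem_iff_lt_colLen.mp h1
  omega

lemma mem_cells_iff {lam : YoungDiagram} {w : ℕ × ℕ} :
    w ∈ lam.cells ↔ w.1 ≤ lam.colLen 0 ∧ w.2 < lam.rowLen w.1 := by
  rw [YoungDiagram.mem_cells, ← Prod.mk.eta (p := w), YoungDiagram.mem_iff_lt_rowLen]
  refine ⟨fun h => ⟨?_, h⟩, fun h => h.2⟩
  by_contra! hlt
  rw [rowLen_eq_zero hlt] at h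
  omega

/-- With `N = lam.colLen 0` the rows 0, …, N include one empty row, so the empty diagram needs no
separate case. -/
lemma isShape_cells (lam : YoungDiagram) : IsShape (lam.colLen 0) 0 lam.rowLen lam.cells := by
  intro w
  rw [mem_cells_iff]
  simp

lemma isShape_sdiff (lam : YoungDiagram) (k : ℕ) :
    IsShape (lam.colLen 0) k lam.rowLen (lam.cells \ (oneRow k).cells) := by
  intro w
  rw [Finset.mem_sdiff, mem_cells_iff, mem_oneRow, and_assoc, not_and, not_lt]

lemma sum_cells {M : Type*} [AddCommMonoid M] (lam : YoungDiagram) (f : ℕ × ℕ → M) :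
    ∑ w ∈ lam.cells, f w =
      ∑ i ∈ range (lam.colLen 0 + 1), ∑ j ∈ range (lam.rowLen i), f (i, j) :=
  Finset.sum_finset_product _ _ _ fun w => by
    rw [mem_cells_iff, Finset.mem_range, Finset.mem_range, Nat.lt_succ_iff]

lemma sum_rowLen (lam : YoungDiagram) :
    ∑ i : Fin (lam.colLen 0 + 1), lam.rowLen i = lam.card := by
  rw [Fin.sum_univ_eq_sum_range lam.rowLen, YoungDiagram.card, Finset.card_eq_sum_ones, sum_cells]
  simp

lemma cast_sum_content_pow (lam : YoungDiagram) (r : ℕ) :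
    ((∑ w ∈ lam.cells, content w ^ r : ℤ) : ℚ) = contentSum lam.rowLen (lam.colLen 0 + 1) r := by
  rw [sum_cells, contentSum, Int.cast_sum]
  refine Finset.sum_congr rfl fun i _ => ?_
  rw [Int.cast_sum]
  refine Finset.sum_congr rfl fun j _ => ?_
  rw [content]
  push_cast
  ring

lemma cast_cp (α : Multiset ℕ+) (lam : YoungDiagram) : (cp α lam : ℚ) =
    (α.map fun a : ℕ+ => contentSum lam.rowLen (lam.colLen 0 + 1) ((a : ℕ) - 1)).prod := by
  simp only [cp, Multiset.bind_def, Multiset.pure_def, Multiset.bind_singleton, Multiset.map_map,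
    Int.cast_multiset_prod, Function.comp_apply, cast_sum_content_pow]

/-- `(n)_4 f^(lam/(4)) / f^lam` as a polynomial in the content power sums. -/
theorem descFactorial_mul_numSkew_div (lam : YoungDiagram) :
    (lam.card.descFactorial 4 : ℚ) * numSkew lam (oneRow 4) / numStandard lam =
      rowFour (contentSum lam.rowLen (lam.colLen 0 + 1)) := by
  have hm : Antitone lam.rowLen := fun i j h => lam.rowLen_anti i j h
  have hN : ∀ i, lam.colLen 0 < i → lam.rowLen i = 0 := fun i h => rowLen_eq_zero h
  have hD := fallingDet_rowExponents_zero_ne_zero (N := lam.colLen 0) hm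
  have h4 := fallingDet_rowExponents_four (lam.colLen 0) lam.rowLen
  have hstd : (numStandard lam : ℚ) * _ = _ := card_standardFilling_mul_prod_factorial lam.card hm hN
    (Nat.zero_le _) (sum_rowLen lam) (isShape_cells lam)
  have hP : ∏ i, ((shifted (lam.colLen 0) lam.rowLen i).factorial : ℚ) ≠ 0 :=
    Finset.prod_ne_zero_iff.mpr fun i _ => by exact_mod_cast Nat.factorial_ne_zero _
  have hf : (numStandard lam : ℚ) ≠ 0 := by
    intro h
    rw [h, zero_mul] at hstd
    exact mul_ne_zero (by exact_mod_cast Nat.factorial_ne_zero _) hD hstd.symm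
  rcases le_or_gt 4 (lam.rowLen 0) with h | h
  · have hn : 4 ≤ lam.card := by
      rw [← sum_rowLen, Fin.sum_univ_succ, Fin.val_zero]
      omega
    have hskew : (numSkew lam (oneRow 4) : ℚ) *
        ∏ i, ((shifted (lam.colLen 0) lam.rowLen i).factorial : ℚ) = (lam.card - 4).factorial *
          fallingDet (shifted (lam.colLen 0) lam.rowLen) (rowExponents (lam.colLen 0) 4) := by
      rw [numSkew, if_pos (oneRow_le_iff.mpr h)]
      exact card_standardFilling_mul_prod_factorial (lam.card - 4) hm hN h
        ((sum_rowLen lam).trans (Nat.sub_add_cancel hn).symm) (isShape_sdiff lam 4)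
    rw [div_eq_iff hf]
    refine mul_right_cancel₀ hP ?_
    have hfac : ((lam.card - 4).factorial : ℚ) * (lam.card.descFactorial 4 : ℚ) =
        lam.card.factorial := by
      exact_mod_cast Nat.factorial_mul_descFactorial hn
    rw [mul_assoc, hskew, mul_assoc, hstd, h4, ← hfac]
    ring
  -- If (4) does not fit, D_4 = 0 while D_0 ≠ 0, so `rowFour` vanishes, in agreement with the
  -- convention f^{λ/(4)} = 0.
  · rw [fallingDet_eq_zero_of_lt hm h] at h4
    rw [(mul_eq_zero.mp h4.symm).resolve_right hD, numSkew,
      if_neg (fun h' => absurd (oneRow_le_iff.mp h') (not_le.mpr h))]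
    simp

end SkewCount

theorem mainTheorem6 (n : ℕ) (lam : YoungDiagram) (hlam : lam.card = n) :
    (n.descFactorial 4 : ℚ) * (SkewCount.numSkew lam (SkewCount.oneRow 4) : ℚ)
        / (SkewCount.numStandard lam : ℚ) =
      1 / 24 * (SkewCount.cp {1, 1, 1, 1} lam : ℚ)
      + 1 / 2 * (SkewCount.cp {2, 1, 1} lam : ℚ)
      + 1 / 2 * (SkewCount.cp {2, 2} lam : ℚ)
      + (SkewCount.cp {3, 1} lam : ℚ)
      + (SkewCount.cp {4} lam : ℚ)
      - 3 / 4 * (SkewCount.cp {1, 1, 1} lam : ℚ)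
      - 9 / 2 * (SkewCount.cp {2, 1} lam : ℚ)
      - 9 / 2 * (SkewCount.cp {3} lam : ℚ)
      + 71 / 24 * (SkewCount.cp {1, 1} lam : ℚ)
      + 6 * (SkewCount.cp {2} lam : ℚ)
      - 9 / 4 * (SkewCount.cp {1} lam : ℚ) := by
  subst hlam
  have e1 : ((1 : ℕ+) : ℕ) - 1 = 0 := rfl
  have e2 : ((2 : ℕ+) : ℕ) - 1 = 1 := rfl
  have e3 : ((3 : ℕ+) : ℕ) - 1 = 2 := rfl
  have e4 : ((4 : ℕ+) : ℕ) - 1 = 3 := rfl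
  rw [SkewCount.descFactorial_mul_numSkew_div]
  simp only [SkewCount.cast_cp, Multiset.insert_eq_cons, Multiset.map_cons, Multiset.map_singleton,
    Multiset.prod_cons, Multiset.prod_singleton, e1, e2, e3, e4]
  simp only [SkewCount.rowFour, SkewCount.g1, SkewCount.g2, SkewCount.g3, SkewCount.g4]
  ring
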